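/- Let $n\ge 1$ and $p\ge 2n+1$. Consider $n$ i.i.d. observations $D_i=(y_i,Z_i,W_i)\in\mathbb R\times\mathbb R\times\mathbb R^{p-1}$ from the linear model $$y_i=Z_i\beta+W_i^\top\gamma+\varepsilon_i,\qquad (Z_i,W_i^\top)^\top\sim\mathcal N_p(0,\Sigma),\qquad \varepsilon_i\sim\mathcal N(0,\sigma^2),$$ with $\varepsilon_i$ independent of $(Z_i,W_i)$ (and $\varepsilon_i=0$ if $\sigma=0$). Let $\mathbb P_\theta$ be the law of the data $D=(D_1,\dots,D_n)$ under the parameter $\theta=(\beta,\gamma,\Sigma,\sigma)$. For $M>1$, let $\Theta$ be the set of all $\theta$ such that the eigenvalues of the symmetric matrix $\Sigma$ lie in $[M^{-1},M]$, the first row of $\Sigma^{-1}$ has at most $s=1$ nonzero entry, $\sigma=0$, and $\beta^2+\|\gamma\|_2^2\le 1$; let $\Theta_I=\{\theta\in\Theta:\Sigma=\mathbb I_p\}$. For a set $\Theta'$ of parameters, let $$L(\Theta')=\inf_{[l,u]}\ \sup_{\theta\in\Theta'}\mathbb E_\theta\,\mathrm{diam}\,[l(D),u(D)],$$ where the infimum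 runs over all intervals with measurable endpoints satisfying $\mathbb P_\theta(l(D)\le\beta\le u(D))\ge 1-\alpha$ for every $\theta\in\Theta'$. For every $\alpha\in(0,1/3)$ there is a constant $C>0$, depending only on $\alpha$, such that for all $n\ge1$, $p\ge 2n+1$ and $M>1$: 1. $L(\Theta)\ge C n^{-1/2}$; 2. $L(\Theta_I)\ge C n^{-1/2}$, that is, the bound holds even if the design covariance is known to be the identity; 3. consequently, exact recovery is impossible: for every measurable estimator $\hat\beta=\hat\beta(D)$ there is $\theta\in\Theta_I$ with $\mathbb P_\theta(\hat\beta=\beta)<1-\alpha$. In particular neither $\beta$ nor the full vector $(\beta,\gamma)$ can be recovered exactly. -/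

import Mathlib

open MeasureTheory ProbabilityTheory
open scoped ENNReal NNReal

noncomputable section

/-- A parameter `θ = (β, γ, Σ, σ)` of the random-design linear model `y = Z β + W γ + ε` with
`q` nuisance coefficients, that is, with `p = q + 1` covariates in total. Index `0` of the
covariance matrix `Σ` corresponds to the covariate `Z`, the index `j + 1` to the `j`-th coordinate
of `W`. -/
structure RegParam (q : ℕ) where
  /-- the scalar coefficient of interest -/
  beta : ℝ
  /-- the nuisance coefficients -/
  gamma : EuclideanSpace ℝ (Fin q)
  /-- the covariance matrix of a design row `X = (Z, W)` -/
  Sigma : Matrix (Fin (q + 1)) (Fin (q + 1)) ℝ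
  /-- the standard deviation of the noise -/
  sigma : ℝ

/-- The full coefficient vector `(β, γ)` with its Euclidean norm. -/
def RegParam.coef {q : ℕ} (θ : RegParam q) : EuclideanSpace ℝ (Fin (q + 1)) :=
  WithLp.toLp 2 (Fin.cons θ.beta fun j => θ.gamma j)

/-- One observation `(y, Z, W)`. -/
abbrev Obs (q : ℕ) : Type := ℝ × ℝ × (Fin q → ℝ)

/-- A sample of `n` observations. -/
abbrev Sample (n q : ℕ) : Type := Fin n → Obs q

/-- The observation produced by the design row `x = (Z, W)` and the noise `e`:
`y = Z β + W γ + e`. -/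
def RegParam.observe {q : ℕ} (θ : RegParam q) (xe : EuclideanSpace ℝ (Fin (q + 1)) × ℝ) : Obs q :=
  (xe.1 0 * θ.beta + ∑ j : Fin q, xe.1 j.succ * θ.gamma j + xe.2, xe.1 0, fun j => xe.1 j.succ)

/-- Law of one observation: the design row is `N(0, Σ)`, the noise is `N(0, σ²)` (the point mass
at `0` if `σ = 0`), and the two are independent. -/
def RegParam.obsLaw {q : ℕ} (θ : RegParam q) : Measure (Obs q) :=
  ((multivariateGaussian 0 θ.Sigma).prod (gaussianReal 0 (Real.toNNReal (θ.sigma ^ 2)))).map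
    θ.observe

/-- Law of the data: `n` independent copies of an observation. -/
def RegParam.law {q : ℕ} (n : ℕ) (θ : RegParam q) : Measure (Sample n q) :=
  Measure.pi fun _ => θ.obsLaw

/-- The parameter space: all eigenvalues of the symmetric matrix `Σ` lie in `[M⁻¹, M]`, the first
row of the precision matrix `Σ⁻¹` has at most `s` nonzero entries, `0 ≤ σ ≤ M₁`, and the full
coefficient vector has Euclidean norm at most `M₂`. -/
def paramSpace (q : ℕ) (M : ℝ) (s : ℕ) (M₁ M₂ : ℝ) : Set (RegParam q) :=
  {θ | (∃ h : θ.Sigma.IsHermitian, ∀ i, M⁻¹ ≤ h.eigenvalues i ∧ h.eigenvalues i ≤ M) ∧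
    {j | θ.Sigma⁻¹ 0 j ≠ 0}.ncard ≤ s ∧
    (0 ≤ θ.sigma ∧ θ.sigma ≤ M₁) ∧
    ‖θ.coef‖ ≤ M₂}

/-- A data-dependent interval `[l(D), u(D)]` with measurable endpoints
(it is empty where `u(D) < l(D)`). -/
structure IntervalProc (n q : ℕ) where
  /-- the left endpoint -/
  lower : Sample n q → ℝ
  /-- the right endpoint -/
  upper : Sample n q → ℝ
  measurable_lower : Measurable lower
  measurable_upper : Measurable upper

/-- The confidence intervals for `β` of level `1 - α` over the parameter set `Θ`. -/
def validCI (n : ℕ) {q : ℕ} (α : ℝ) (Θ : Set (RegParam q)) : Set (IntervalProc n q) :=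
  {I | ∀ θ ∈ Θ,
    ENNReal.ofReal (1 - α) ≤ θ.law n {D | I.lower D ≤ θ.beta ∧ θ.beta ≤ I.upper D}}

/-- The expected diameter of the interval under `θ`. It is a Lebesgue integral with values in
`[0, ∞]`, so that it makes sense for every interval; an empty interval has diameter `0`. -/
def expectedLength {n q : ℕ} (I : IntervalProc n q) (θ : RegParam q) : ℝ≥0∞ :=
  ∫⁻ D, ENNReal.ofReal (I.upper D - I.lower D) ∂(θ.law n)

/-- The minimax expected length over `Θ₁` of the confidence intervals that are valid over `Θ`. -/
def minimaxLength (n : ℕ) {q : ℕ} (α : ℝ) (Θ₁ Θ : Set (RegParam q)) : ℝ≥0∞ :=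
  ⨅ I ∈ validCI n α Θ, ⨆ θ ∈ Θ₁, expectedLength I θ

/-- The minimax length over the parameter space `paramSpace q M s M₁ M₂`. -/
def minimaxA (n q : ℕ) (α M : ℝ) (s : ℕ) (M₁ M₂ : ℝ) : ℝ≥0∞ :=
  minimaxLength n α (paramSpace q M s M₁ M₂) (paramSpace q M s M₁ M₂)

/-- The part of the parameter space in which the design covariance is the identity matrix. -/
def identitySpace (q : ℕ) (M : ℝ) (s : ℕ) (M₁ M₂ : ℝ) : Set (RegParam q) :=
  {θ ∈ paramSpace q M s M₁ M₂ | θ.Sigma = 1}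

end

noncomputable section

open scoped RealInnerProductSpace

/-! ### Gaussian vectors: resampling, anti-concentration, covering bounds. -/

section GaussianFacts

/-! The bound is Bayesian. Take identity covariance, no noise, and the prior `s • ξ` on the first
`2n+1` coefficients, with `ξ` standard Gaussian and zeros elsewhere. The data then reveal only the
design and the projection of `ξ` onto the span `K` of the `n` truncated design rows. Given the data,
`β = s⟪e₀, ξ⟫` is still Gaussian, with standard deviation `s‖e₀ - P_K e₀‖`, so an interval covers it
with probability at most its length divided by this number (`stdGaussian_cover_le`).

The residual is rarely small: the leverages `‖P_K e_j‖²` sum to `dim K ≤ n`, and the coordinates are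
exchangeable, so the average leverage of `e₀` is at most `n/(2n+1) < 1/2`
(`measure_nearRowSpace_le`). With probability almost `1/2` or more it is therefore bounded below,
which is incompatible with coverage above `2/3` by short intervals.

Using `2n+1` active coordinates rather than all `p` allows `s` of order `n^(-1/2)` while the prior
stays mostly in the unit ball; this gives a rate free of `p`. `coverage_le_length` averages coverage
and length over the prior, and `length_lower_bound` inserts the constants. -/

theorem charFun_map_of_inner_eq {E F : Type*} [NormedAddCommGroup E]
    [InnerProductSpace ℝ E] [MeasurableSpace E] [NormedAddCommGroup F] [InnerProductSpace ℝ F]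
    [MeasurableSpace F] [BorelSpace F] [FiniteDimensional ℝ F] {μ : Measure E}
    {A : E → F} (hA : Measurable A) {B : F → E}
    (h : ∀ x t, ⟪A x, t⟫ = ⟪x, B t⟫) (t : F) : charFun (μ.map A) t = charFun μ (B t) := by
  rw [charFun_apply, charFun_apply, integral_map hA.aemeasurable (by fun_prop)]
  simp_rw [h]

variable {E F : Type*} [NormedAddCommGroup E] [InnerProductSpace ℝ E] [FiniteDimensional ℝ E]
  [MeasurableSpace E] [BorelSpace E] [NormedAddCommGroup F] [InnerProductSpace ℝ F]
  [FiniteDimensional ℝ F] [MeasurableSpace F] [BorelSpace F]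

/-- The image of a standard Gaussian under the adjoint of an isometric embedding. -/
theorem map_stdGaussian_of_inner_eq (ι : F →ₗᵢ[ℝ] E) {A : E → F} (hA : Measurable A)
    (h : ∀ x t, ⟪A x, t⟫ = ⟪x, ι t⟫) : (stdGaussian E).map A = stdGaussian F := by
  have := Measure.isProbabilityMeasure_map (μ := stdGaussian E) hA.aemeasurable
  apply Measure.ext_of_charFun
  ext t
  rw [charFun_map_of_inner_eq hA h, charFun_stdGaussian, charFun_stdGaussian, ι.norm_map]

/-- Resampling the component of a standard Gaussian vector orthogonal to a subspace does not
change its law. -/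
theorem map_resample_stdGaussian (K : Submodule ℝ F) :
    ((stdGaussian F).prod (stdGaussian F)).map
      (fun z => K.starProjection z.1 + Kᗮ.starProjection z.2) = stdGaussian F := by
  have hA : Measurable fun z : F × F => K.starProjection z.1 + Kᗮ.starProjection z.2 := by fun_prop
  have := Measure.isProbabilityMeasure_map (μ := (stdGaussian F).prod (stdGaussian F))
    hA.aemeasurable
  have h1 := Measure.isProbabilityMeasure_map (μ := stdGaussian F)
    (f := K.starProjection) (by fun_prop)
  have h2 := Measure.isProbabilityMeasure_map (μ := stdGaussian F)
    (f := Kᗮ.starProjection) (by fun_prop)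
  apply Measure.ext_of_charFun
  have e : (fun z : F × F => K.starProjection z.1 + Kᗮ.starProjection z.2)
      = (fun p : F × F => p.1 + p.2) ∘ Prod.map K.starProjection Kᗮ.starProjection := rfl
  rw [e, ← Measure.map_map (by fun_prop) (by fun_prop),
    ← Measure.map_prod_map _ _ (by fun_prop) (by fun_prop), charFun_map_add_prod_eq_mul]
  ext t
  rw [Pi.mul_apply, charFun_map_of_inner_eq (by fun_prop) K.inner_starProjection_left_eq_right,
    charFun_map_of_inner_eq (by fun_prop) Kᗮ.inner_starProjection_left_eq_right,
    charFun_stdGaussian, charFun_stdGaussian, charFun_stdGaussian, ← Complex.exp_add]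
  have := Submodule.norm_sq_eq_add_norm_sq_starProjection t K
  congr 1
  -- The characteristic functions multiply to the standard one because `‖t‖²` splits by Pythagoras.
  rw [← Complex.ofReal_pow ‖t‖, this]
  push_cast
  ring

theorem gaussianReal_Icc_le (v : ℝ≥0) (hv : v ≠ 0) (a b : ℝ) :
    gaussianReal 0 v (Set.Icc a b) ≤ ENNReal.ofReal ((b - a) / √v) := by
  have hv' : (0 : ℝ) < v := by positivity
  have hs : 0 < √(v : ℝ) := Real.sqrt_pos.2 hv'
  rw [gaussianReal_apply 0 hv, div_eq_mul_inv, mul_comm,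
    ENNReal.ofReal_mul (by positivity), ← Real.volume_Icc, ← setLIntegral_const]
  refine lintegral_mono fun x => ENNReal.ofReal_le_ofReal ?_
  rw [gaussianPDFReal]
  have h1 : (√(2 * Real.pi * v))⁻¹ ≤ (√(v : ℝ))⁻¹ := by
    gcongr
    nlinarith [Real.pi_gt_three]
  have h2 : Real.exp (-(x - 0) ^ 2 / (2 * v)) ≤ 1 := by
    rw [Real.exp_le_one_iff]
    apply div_nonpos_of_nonpos_of_nonneg <;> nlinarith [sq_nonneg (x - 0)]
  calc _ ≤ (√(v : ℝ))⁻¹ * 1 := by gcongr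
    _ = _ := mul_one _

theorem map_inner_stdGaussian (v : F) :
    (stdGaussian F).map (fun x => ⟪v, x⟫) = gaussianReal 0 (‖v‖₊ ^ 2) := by
  have hm : Measurable fun x : F => ⟪v, x⟫ := by fun_prop
  have := Measure.isProbabilityMeasure_map (μ := stdGaussian F) hm.aemeasurable
  apply Measure.ext_of_charFun
  ext t
  rw [charFun_map_of_inner_eq hm (B := fun t => t • v), charFun_stdGaussian, charFun_gaussianReal]
  · rw [norm_smul, ← Complex.ofReal_pow, mul_pow, Real.norm_eq_abs, sq_abs]
    congr 1
    push_cast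
    ring
  · intro x t
    rw [real_inner_smul_right, real_inner_comm x v]
    simp

theorem stdGaussian_slab_le (v : F) (hv : v ≠ 0) (a b : ℝ) :
    stdGaussian F {x | a ≤ ⟪v, x⟫ ∧ ⟪v, x⟫ ≤ b} ≤ ENNReal.ofReal ((b - a) / ‖v‖) := by
  have h := gaussianReal_Icc_le (‖v‖₊ ^ 2) (by simpa using hv) a b
  rw [← map_inner_stdGaussian, Measure.map_apply (by fun_prop) measurableSet_Icc] at h
  simpa [Set.preimage, Set.mem_Icc] using h

/-- A Gaussian linear functional `⟪e, x⟫` of which only the projection of `x` to `K` is observed is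
covered by an interval with probability at most a multiple of its length. -/
theorem stdGaussian_cover_le (K : Submodule ℝ F) (e : F) {s r : ℝ} (hs : 0 < s) (hr : 0 < r)
    (he : r ≤ ‖e - K.starProjection e‖) {l u : F → ℝ} (hl : Measurable l) (hu : Measurable u)
    (hlK : ∀ x, l x = l (K.starProjection x)) (huK : ∀ x, u x = u (K.starProjection x)) :
    stdGaussian F {x | l x ≤ s * ⟪e, x⟫ ∧ s * ⟪e, x⟫ ≤ u x} ≤
      ∫⁻ x, min 1 (ENNReal.ofReal ((s * r)⁻¹) * ENNReal.ofReal (u x - l x)) ∂stdGaussian F := by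
  set v := e - K.starProjection e with hv
  have hv0 : 0 < ‖v‖ := hr.trans_le he
  have hmA : MeasurableSet {x | l x ≤ s * ⟪e, x⟫ ∧ s * ⟪e, x⟫ ≤ u x} :=
    (measurableSet_le hl (by fun_prop)).inter (measurableSet_le (by fun_prop) hu)
  have hm : Measurable fun z : F × F => K.starProjection z.1 + Kᗮ.starProjection z.2 := by fun_prop
  conv_lhs => rw [← map_resample_stdGaussian K]
  rw [Measure.map_apply hm hmA, Measure.prod_apply (hm hmA)]
  -- Fix `x`, hence the observed component; only the resampled component `y` is random.
  refine lintegral_mono fun x => le_min prob_le_one ?_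
  have hproj (y : F) : K.starProjection (K.starProjection x + Kᗮ.starProjection y)
      = K.starProjection x := by
    have h0 : K.starProjection (Kᗮ.starProjection y) = 0 :=
      K.starProjection_apply_eq_zero_iff.2 (Submodule.starProjection_apply_mem _ _)
    rw [map_add, h0, add_zero, Submodule.starProjection_eq_self_iff]
    exact Submodule.starProjection_apply_mem _ _
  have hin (y : F) : ⟪e, K.starProjection x + Kᗮ.starProjection y⟫
      = ⟪e, K.starProjection x⟫ + ⟪v, y⟫ := by
    rw [inner_add_right, ← Submodule.inner_starProjection_left_eq_right,
      ← Submodule.inner_starProjection_left_eq_right, Submodule.starProjection_orthogonal_val]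
  set a := ⟪e, K.starProjection x⟫
  -- The endpoints are constant in `y`, so coverage confines `⟪v, y⟫` to a fixed slab.
  have hsub : (Prod.mk x ⁻¹' ((fun z : F × F => K.starProjection z.1 + Kᗮ.starProjection z.2) ⁻¹'
      {x | l x ≤ s * ⟪e, x⟫ ∧ s * ⟪e, x⟫ ≤ u x})) ⊆
      {y | l x / s - a ≤ ⟪v, y⟫ ∧ ⟪v, y⟫ ≤ u x / s - a} := by
    rintro y ⟨h1, h2⟩
    simp only at h1 h2
    rw [hlK, hproj, ← hlK, hin] at h1
    rw [huK, hproj, ← huK, hin] at h2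
    constructor
    · rw [sub_le_iff_le_add, div_le_iff₀ hs]; linarith
    · rw [le_sub_iff_add_le, le_div_iff₀ hs]; linarith
  refine (measure_mono hsub).trans ((stdGaussian_slab_le v (norm_pos_iff.1 hv0) _ _).trans ?_)
  rw [← ENNReal.ofReal_mul (by positivity)]
  rcases le_total (u x) (l x) with h | h
  · rw [ENNReal.ofReal_of_nonpos]
    · exact zero_le
    · apply div_nonpos_of_nonpos_of_nonneg _ hv0.le
      have : u x / s ≤ l x / s := by gcongr
      linarith
  · apply ENNReal.ofReal_le_ofReal
    have : (u x / s - a - (l x / s - a)) / ‖v‖ = (s * ‖v‖)⁻¹ * (u x - l x) := by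
      field_simp
      ring
    rw [this]
    have := sub_nonneg.2 h
    gcongr

end GaussianFacts

/-! ### Leverage scores of a Gaussian design, and the norm of the prior. -/

section LeverageScores

variable {ι : Type*} [Fintype ι]

/-- The trace of an orthogonal projection is its rank. -/
theorem sum_norm_sq_starProjection (K : Submodule ℝ (EuclideanSpace ℝ ι)) [DecidableEq ι] :
    ∑ j, ‖K.starProjection (EuclideanSpace.single j 1)‖ ^ 2 = Module.finrank ℝ K := by
  let b := stdOrthonormalBasis ℝ K
  have h (j : ι) : ‖K.starProjection (EuclideanSpace.single j 1)‖ ^ 2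
      = ∑ k, ((b k : EuclideanSpace ℝ ι) j) ^ 2 := by
    rw [Submodule.starProjection_apply, ← Submodule.coe_norm, ← b.sum_sq_norm_inner_right]
    refine Finset.sum_congr rfl fun k _ => ?_
    rw [Submodule.inner_orthogonalProjectionOnto_eq_of_mem_left, EuclideanSpace.inner_single_right]
    simp
  simp_rw [h]
  rw [Finset.sum_comm]
  have (k : Fin (Module.finrank ℝ K)) : ∑ j, ((b k : EuclideanSpace ℝ ι) j) ^ 2 = 1 := by
    rw [← EuclideanSpace.real_norm_sq_eq, ← Submodule.coe_norm, b.norm_eq_one, one_pow]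
  simp [this]

/-- The design matrices whose row space comes close to the `j`-th coordinate vector. -/
def nearRowSpace (n : ℕ) (η : ℝ) (j : ι) [DecidableEq ι] : Set (Fin n → EuclideanSpace ℝ ι) :=
  {X | ∃ y : Fin n → ℝ, ‖EuclideanSpace.single j 1 - ∑ i, y i • X i‖ ^ 2 < η}

variable [DecidableEq ι] {n : ℕ} {η : ℝ}

theorem isOpen_nearRowSpace (j : ι) : IsOpen (nearRowSpace n η j) := by
  have : nearRowSpace n η j = ⋃ y : Fin n → ℝ, {X : Fin n → EuclideanSpace ℝ ι |
      ‖EuclideanSpace.single j 1 - ∑ i, y i • X i‖ ^ 2 < η} := by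
    ext; simp [nearRowSpace]
  rw [this]
  exact isOpen_iUnion fun y => isOpen_lt (by fun_prop) continuous_const

/-- The projection is the nearest point of the span. The existential form makes openness and
permutation symmetry immediate; this one gives access to leverages. -/
theorem mem_nearRowSpace_iff (X : Fin n → EuclideanSpace ℝ ι) (j : ι) :
    X ∈ nearRowSpace n η j ↔
      ‖EuclideanSpace.single j 1 -
        (Submodule.span ℝ (Set.range X)).starProjection (EuclideanSpace.single j 1)‖ ^ 2 < η := by
  set K := Submodule.span ℝ (Set.range X)
  constructor
  · rintro ⟨y, hy⟩
    refine lt_of_le_of_lt ?_ hy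
    have hyK : ∑ i, y i • X i ∈ K :=
      K.sum_mem fun i _ => K.smul_mem _ (Submodule.subset_span ⟨i, rfl⟩)
    rw [Submodule.starProjection_minimal]
    refine pow_le_pow_left₀ (Real.iInf_nonneg fun _ => norm_nonneg _) ?_ 2
    exact ciInf_le (f := fun w : K => ‖EuclideanSpace.single j (1 : ℝ) - w‖)
      ⟨0, by rintro _ ⟨w, rfl⟩; positivity⟩ ⟨_, hyK⟩
  · intro h
    obtain ⟨y, hy⟩ := (Submodule.mem_span_range_iff_exists_fun ℝ).1
      (Submodule.starProjection_apply_mem K (EuclideanSpace.single j 1))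
    exact ⟨y, by rwa [hy]⟩

/-- A residual below `η` forces a leverage above `1 - η`, and the leverages sum to the rank, at most
`n`. -/
theorem sum_indicator_nearRowSpace_le (hη : η < 1) (X : Fin n → EuclideanSpace ℝ ι) :
    ∑ j, (nearRowSpace n η j).indicator (1 : (Fin n → EuclideanSpace ℝ ι) → ℝ≥0∞) X ≤
      ENNReal.ofReal (n / (1 - η)) := by
  set K := Submodule.span ℝ (Set.range X)
  have hη' : 0 < 1 - η := sub_pos.2 hη
  have key (j : ι) : (nearRowSpace n η j).indicator (1 : (Fin n → EuclideanSpace ℝ ι) → ℝ≥0∞) X ≤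
      ENNReal.ofReal (‖K.starProjection (EuclideanSpace.single j 1)‖ ^ 2 / (1 - η)) := by
    by_cases h : X ∈ nearRowSpace n η j
    · rw [Set.indicator_of_mem h, Pi.one_apply, ENNReal.one_le_ofReal, one_le_div hη']
      rw [mem_nearRowSpace_iff] at h
      have := Submodule.norm_sq_eq_add_norm_sq_starProjection (EuclideanSpace.single j (1 : ℝ)) K
      rw [Submodule.starProjection_orthogonal_val] at this
      simp only [PiLp.norm_single, norm_one, one_pow] at this
      linarith
    · simp [Set.indicator_of_notMem h]
  calc _ ≤ _ := Finset.sum_le_sum fun j _ => key j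
    _ = ENNReal.ofReal (Module.finrank ℝ K / (1 - η)) := by
      rw [← ENNReal.ofReal_sum_of_nonneg fun j _ => by positivity, ← Finset.sum_div,
        sum_norm_sq_starProjection]
    _ ≤ _ := by
      gcongr
      exact (finrank_range_le_card (R := ℝ) X).trans_eq (Fintype.card_fin n)

/-- Swapping two coordinates is an isometry, which preserves the standard Gaussian law of each row.
-/
theorem measure_nearRowSpace_eq (i j : ι) :
    Measure.pi (fun _ : Fin n => stdGaussian (EuclideanSpace ℝ ι)) (nearRowSpace n η i) =
      Measure.pi (fun _ : Fin n => stdGaussian (EuclideanSpace ℝ ι)) (nearRowSpace n η j) := by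
  let f := LinearIsometryEquiv.piLpCongrLeft 2 ℝ ℝ (Equiv.swap i j)
  have hf : MeasurePreserving f (stdGaussian (EuclideanSpace ℝ ι)) (stdGaussian _) :=
    ⟨by fun_prop, stdGaussian_map f⟩
  have hF := measurePreserving_pi (fun _ : Fin n => stdGaussian (EuclideanSpace ℝ ι)) _
    fun _ => hf
  rw [← hF.measure_preimage (isOpen_nearRowSpace j).measurableSet.nullMeasurableSet]
  congr 1
  ext X
  simp only [nearRowSpace, Set.mem_ofPred_eq, Set.mem_preimage]
  refine exists_congr fun y => ?_
  rw [← f.norm_map]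
  simp [f, map_sub, map_sum]

theorem measure_nearRowSpace_le (hη : η < 1) (j : ι) :
    Fintype.card ι * Measure.pi (fun _ : Fin n => stdGaussian (EuclideanSpace ℝ ι))
      (nearRowSpace n η j) ≤ ENNReal.ofReal (n / (1 - η)) := by
  set ν := Measure.pi (fun _ : Fin n => stdGaussian (EuclideanSpace ℝ ι))
  have hm (i : ι) : MeasurableSet (nearRowSpace n η i) := (isOpen_nearRowSpace i).measurableSet
  calc _ = ∑ i : ι, ν (nearRowSpace n η i) := by
        simp [ν, measure_nearRowSpace_eq _ j]
    _ = ∫⁻ X, ∑ i, (nearRowSpace n η i).indicator (1 : (Fin n → EuclideanSpace ℝ ι) → ℝ≥0∞) X ∂ν := by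
        rw [lintegral_finsetSum _ fun i _ => measurable_one.indicator (hm i)]
        simp_rw [lintegral_indicator_one (hm _)]
    _ ≤ ∫⁻ X, ENNReal.ofReal (n / (1 - η)) ∂ν :=
        lintegral_mono fun X => sum_indicator_nearRowSpace_le hη X
    _ = _ := by simp [ν]

/-- Markov's inequality for `‖s • x‖²`. It bounds the prior mass outside the parameter space. -/
theorem stdGaussian_norm_gt_one_le {s : ℝ} :
    stdGaussian (EuclideanSpace ℝ ι) {x | 1 < ‖s • x‖} ≤
      ENNReal.ofReal (s ^ 2 * Fintype.card ι) := by
  have h1 (j : ι) : ∫⁻ x, ENNReal.ofReal (x j ^ 2) ∂stdGaussian (EuclideanSpace ℝ ι) = 1 := by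
    have h := measurePreserving_eval_multivariateGaussian (ι := ι) (μ := 0) (S := 1)
      Matrix.PosSemidef.one (i := j)
    rw [multivariateGaussian_zero_one] at h
    have h2 := h.lintegral_comp (f := fun t => ENNReal.ofReal (t ^ 2)) (by fun_prop)
    rw [h2]
    simp only [PiLp.zero_apply, Matrix.one_apply_eq, Real.toNNReal_one]
    have hv := variance_id_gaussianReal (μ := 0) (v := 1)
    rw [variance_of_integral_eq_zero (by fun_prop) (by simp)] at hv
    rw [← ofReal_integral_eq_lintegral_ofReal]
    · have : ∫ x, x ^ 2 ∂gaussianReal 0 1 = 1 := by simpa using hv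
      rw [this]; simp
    · simpa using (memLp_id_gaussianReal (μ := 0) (v := 1) 2).integrable_sq
    · exact ae_of_all _ fun x => sq_nonneg x
  calc _ ≤ stdGaussian (EuclideanSpace ℝ ι) {x | 1 ≤ ENNReal.ofReal (‖s • x‖ ^ 2)} := by
        refine measure_mono fun x (hx : 1 < ‖s • x‖) => ?_
        rw [Set.mem_ofPred_eq, ENNReal.one_le_ofReal]
        nlinarith
    _ ≤ ∫⁻ x, ENNReal.ofReal (‖s • x‖ ^ 2) ∂stdGaussian (EuclideanSpace ℝ ι) := by
        have := mul_meas_ge_le_lintegral (μ := stdGaussian (EuclideanSpace ℝ ι))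
          (f := fun x => ENNReal.ofReal (‖s • x‖ ^ 2)) (by fun_prop) 1
        rwa [one_mul] at this
    _ = ∫⁻ x, ENNReal.ofReal (s ^ 2) * ∑ j, ENNReal.ofReal (x j ^ 2)
          ∂stdGaussian (EuclideanSpace ℝ ι) := by
        refine lintegral_congr fun x => ?_
        rw [← ENNReal.ofReal_sum_of_nonneg fun j _ => sq_nonneg _,
          ← ENNReal.ofReal_mul (sq_nonneg s), norm_smul, mul_pow, EuclideanSpace.real_norm_sq_eq]
        simp
    _ = _ := by
        rw [lintegral_const_mul _ (by fun_prop), lintegral_finsetSum _ (by fun_prop)]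
        simp_rw [h1]
        rw [ENNReal.ofReal_mul (sq_nonneg s)]
        simp

end LeverageScores

/-! ### The noiseless submodel with identity covariance. -/

section NoiselessModel

/-- The noiseless parameter with identity covariance and coefficient vector `x`. -/
def RegParam.noiseless {q : ℕ} (x : EuclideanSpace ℝ (Fin (q + 1))) : RegParam q where
  beta := x 0
  gamma := WithLp.toLp 2 fun j => x j.succ
  Sigma := 1
  sigma := 0

theorem RegParam.coef_noiseless {q : ℕ} (x : EuclideanSpace ℝ (Fin (q + 1))) :
    (RegParam.noiseless x).coef = x := by
  ext i
  refine Fin.cases ?_ (fun j => ?_) i <;> simp [RegParam.coef, RegParam.noiseless]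

theorem RegParam.noiseless_mem_identitySpace {q : ℕ} {M : ℝ} (hM : 1 < M)
    {x : EuclideanSpace ℝ (Fin (q + 1))} (hx : ‖x‖ ≤ 1) :
    RegParam.noiseless x ∈ identitySpace q M 1 0 1 := by
  refine ⟨⟨⟨Matrix.isHermitian_one, fun i => ?_⟩, ?_, ⟨le_rfl, le_rfl⟩, ?_⟩, rfl⟩
  · have h : (Matrix.isHermitian_one (n := Fin (q + 1)) (α := ℝ)).eigenvalues i = 1 := by
      have h1 := (Matrix.isHermitian_one (n := Fin (q + 1)) (α := ℝ)).eigenvalues_mem_spectrum_real i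
      rw [spectrum.one_eq] at h1
      exact h1
    exact ⟨(inv_le_one_of_one_le₀ hM.le).trans_eq h.symm, h.trans_le hM.le⟩
  · calc _ ≤ ({0} : Set (Fin (q + 1))).ncard := by
          refine Set.ncard_le_ncard fun j hj => ?_
          by_contra h
          exact hj (by simp [RegParam.noiseless, Matrix.one_apply_ne (Ne.symm h)])
      _ = 1 := Set.ncard_singleton 0
  · rwa [RegParam.coef_noiseless]

/-- The sample produced by the design `X` and the coefficient vector `x` without noise. -/
def noiselessSample {n q : ℕ} (x : EuclideanSpace ℝ (Fin (q + 1)))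
    (X : Fin n → EuclideanSpace ℝ (Fin (q + 1))) : Sample n q :=
  fun i => (⟪X i, x⟫, X i 0, fun j => X i j.succ)

theorem measurable_noiselessSample {n q : ℕ} :
    Measurable fun z : EuclideanSpace ℝ (Fin (q + 1)) ×
      (Fin n → EuclideanSpace ℝ (Fin (q + 1))) => noiselessSample z.1 z.2 := by
  unfold noiselessSample
  fun_prop

theorem RegParam.law_noiseless {n q : ℕ} (x : EuclideanSpace ℝ (Fin (q + 1))) :
    (RegParam.noiseless x).law n =
      (Measure.pi fun _ : Fin n => stdGaussian (EuclideanSpace ℝ (Fin (q + 1)))).map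
        (noiselessSample x) := by
  have hf : Measurable fun v : EuclideanSpace ℝ (Fin (q + 1)) =>
      ((⟪v, x⟫, v 0, fun j => v j.succ) : Obs q) := by fun_prop
  have ho : Measurable (RegParam.noiseless x).observe := by
    unfold RegParam.observe
    fun_prop
  have h : (RegParam.noiseless x).obsLaw = (stdGaussian (EuclideanSpace ℝ (Fin (q + 1)))).map
      fun v => ((⟪v, x⟫, v 0, fun j => v j.succ) : Obs q) := by
    have h0 : Real.toNNReal ((RegParam.noiseless x).sigma ^ 2) = 0 := by
      simp [RegParam.noiseless]
    have h1 : (RegParam.noiseless x).Sigma = 1 := rfl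
    rw [RegParam.obsLaw, h0, h1, multivariateGaussian_zero_one, gaussianReal_zero_var,
      Measure.prod_dirac, Measure.map_map ho (by fun_prop)]
    congr 1
    ext v : 1
    simp only [Function.comp_apply, RegParam.observe, RegParam.noiseless, add_zero,
      PiLp.inner_apply, Fin.sum_univ_succ, RCLike.inner_apply, conj_trivial]
    simp only [mul_comm]
  have := Measure.isProbabilityMeasure_map (μ := stdGaussian (EuclideanSpace ℝ (Fin (q + 1))))
    hf.aemeasurable
  rw [RegParam.law, h, ← Measure.pi_map_pi fun _ => hf.aemeasurable]
  rfl

end NoiselessModel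

/-! ### Restriction to the first coordinates. -/

section CoordinateEmbedding

/-- The embedding of `ℝᵐ` in `ℝᵏ` as the first `m` coordinates. -/
def padZeros {m k : ℕ} (h : m ≤ k) : EuclideanSpace ℝ (Fin m) →ₗᵢ[ℝ] EuclideanSpace ℝ (Fin k) where
  toFun x := WithLp.toLp 2 fun i => if hi : i.1 < m then x ⟨i, hi⟩ else 0
  map_add' x y := by ext i; simp only [PiLp.add_apply]; split_ifs <;> simp
  map_smul' c x := by ext i; simp only [PiLp.smul_apply]; split_ifs <;> simp
  norm_map' x := by
    rw [← sq_eq_sq₀ (norm_nonneg _) (norm_nonneg _), EuclideanSpace.real_norm_sq_eq,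
      EuclideanSpace.real_norm_sq_eq]
    refine (Fintype.sum_of_injective (Fin.castLE h) (Fin.castLE_injective h) _ _ ?_ ?_).symm
    · intro i hi
      have : ¬ i.1 < m := fun hi' => hi ⟨⟨i, hi'⟩, rfl⟩
      simp [this]
    · intro i
      simp

variable {m k : ℕ} (h : m ≤ k)

/-- The first `m` coordinates of a vector in `ℝᵏ`. -/
def firstCoords (x : EuclideanSpace ℝ (Fin k)) : EuclideanSpace ℝ (Fin m) :=
  WithLp.toLp 2 fun i => x (Fin.castLE h i)

theorem measurable_firstCoords : Measurable (firstCoords h) := by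
  unfold firstCoords
  fun_prop

theorem padZeros_castLE (x : EuclideanSpace ℝ (Fin m)) (i : Fin m) :
    padZeros h x (Fin.castLE h i) = x i := by
  simp [padZeros]

theorem inner_firstCoords (x : EuclideanSpace ℝ (Fin k)) (t : EuclideanSpace ℝ (Fin m)) :
    ⟪firstCoords h x, t⟫ = ⟪x, padZeros h t⟫ := by
  rw [PiLp.inner_apply, PiLp.inner_apply]
  refine Fintype.sum_of_injective (Fin.castLE h) (Fin.castLE_injective h) _ _ ?_ ?_
  · intro i hi
    have : ¬ i.1 < m := fun hi' => hi ⟨⟨i, hi'⟩, rfl⟩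
    simp [padZeros, this]
  · intro i
    rw [padZeros_castLE]
    rfl

theorem measure_firstCoords_nearRowSpace (n : ℕ) (η : ℝ) (j : Fin m) :
    Measure.pi (fun _ : Fin n => stdGaussian (EuclideanSpace ℝ (Fin k)))
      {X | (fun i => firstCoords h (X i)) ∈ nearRowSpace n η j} =
    Measure.pi (fun _ : Fin n => stdGaussian (EuclideanSpace ℝ (Fin m))) (nearRowSpace n η j) := by
  have hf : MeasurePreserving (firstCoords h) (stdGaussian (EuclideanSpace ℝ (Fin k)))
      (stdGaussian (EuclideanSpace ℝ (Fin m))) :=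
    ⟨measurable_firstCoords h,
      map_stdGaussian_of_inner_eq (padZeros h) (measurable_firstCoords h) (inner_firstCoords h)⟩
  exact (measurePreserving_pi _ _ fun _ : Fin n => hf).measure_preimage
    (isOpen_nearRowSpace j).measurableSet.nullMeasurableSet

end CoordinateEmbedding

/-! ### The Bayesian argument and the minimax bound. -/

section MinimaxBound

variable {n q m : ℕ} (I : IntervalProc n q)

/-- The coefficient vector with scaled coordinates `s • ξ` followed by zeros. -/
def scaledCoef (h : m + 1 ≤ q + 1) (s : ℝ) (ξ : EuclideanSpace ℝ (Fin (m + 1))) :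
    EuclideanSpace ℝ (Fin (q + 1)) :=
  padZeros h (s • ξ)

theorem measurable_scaledCoef (h : m + 1 ≤ q + 1) (s : ℝ) : Measurable (scaledCoef h s) :=
  ((padZeros h).continuous.comp (continuous_const_smul s)).measurable

theorem scaledCoef_zero (h : m + 1 ≤ q + 1) (s : ℝ) (ξ : EuclideanSpace ℝ (Fin (m + 1))) :
    scaledCoef h s ξ 0 = s * ⟪EuclideanSpace.single 0 1, ξ⟫ := by
  have := padZeros_castLE h (s • ξ) 0
  rw [Fin.castLE_zero] at this
  rw [scaledCoef, this]
  simp [EuclideanSpace.inner_single_left]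

/-- For a fixed design, the responses are inner products of `s • ξ` with the truncated rows, so the
sample depends on `ξ` only through its projection to their span. -/
theorem cover_le_of_notMem_nearRowSpace (h : m + 1 ≤ q + 1) {s r : ℝ} (hs : 0 < s) (hr : 0 < r)
    (X : Fin n → EuclideanSpace ℝ (Fin (q + 1)))
    (hX : (fun i => firstCoords h (X i)) ∉ nearRowSpace n (r ^ 2) 0) :
    stdGaussian (EuclideanSpace ℝ (Fin (m + 1)))
      {ξ | I.lower (noiselessSample (scaledCoef h s ξ) X) ≤ scaledCoef h s ξ 0 ∧
        scaledCoef h s ξ 0 ≤ I.upper (noiselessSample (scaledCoef h s ξ) X)} ≤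
    ∫⁻ ξ, min 1 (ENNReal.ofReal ((s * r)⁻¹) *
      ENNReal.ofReal (I.upper (noiselessSample (scaledCoef h s ξ) X) -
        I.lower (noiselessSample (scaledCoef h s ξ) X)))
      ∂stdGaussian (EuclideanSpace ℝ (Fin (m + 1))) := by
  set K := Submodule.span ℝ (Set.range fun i => firstCoords h (X i)) with hK
  rw [mem_nearRowSpace_iff, not_lt, ← hK] at hX
  have hD (ξ : EuclideanSpace ℝ (Fin (m + 1))) :
      noiselessSample (scaledCoef h s ξ) X =
        noiselessSample (scaledCoef h s (K.starProjection ξ)) X := by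
    funext i
    have hi : K.starProjection (firstCoords h (X i)) = firstCoords h (X i) :=
      Submodule.starProjection_eq_self_iff.2 (Submodule.subset_span ⟨i, rfl⟩)
    simp only [noiselessSample, scaledCoef, ← inner_firstCoords, real_inner_smul_right]
    rw [← Submodule.inner_starProjection_left_eq_right, hi]
  have hDm : Measurable fun ξ => noiselessSample (scaledCoef h s ξ) X :=
    measurable_noiselessSample.comp ((measurable_scaledCoef h s).prodMk measurable_const)
  simp_rw [scaledCoef_zero]
  exact stdGaussian_cover_le K _ hs hr ((sq_le_sq₀ hr.le (norm_nonneg _)).1 hX)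
    (I.measurable_lower.comp hDm) (I.measurable_upper.comp hDm)
    (fun ξ => congrArg I.lower (hD ξ)) (fun ξ => congrArg I.upper (hD ξ))

/-- Joint coverage under prior and design is at least `1 - α` times the prior mass of the unit ball.
Fubini bounds it from above by conditioning on the design instead. The three terms on the right are
bad designs, coefficients outside the ball, and length. -/
theorem coverage_le_length (h : m + 1 ≤ q + 1) {M α s r : ℝ} (hM : 1 < M) (hs : 0 < s) (hr : 0 < r)
    (hI : I ∈ validCI n α (identitySpace q M 1 0 1)) {L : ℝ≥0∞}
    (hL : ∀ θ ∈ identitySpace q M 1 0 1, expectedLength I θ ≤ L) :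
    ENNReal.ofReal (1 - α) *
        stdGaussian (EuclideanSpace ℝ (Fin (m + 1))) {ξ | 1 < ‖s • ξ‖}ᶜ ≤
      Measure.pi (fun _ : Fin n => stdGaussian (EuclideanSpace ℝ (Fin (m + 1))))
          (nearRowSpace n (r ^ 2) 0) +
        (stdGaussian (EuclideanSpace ℝ (Fin (m + 1))) {ξ | 1 < ‖s • ξ‖} +
          ENNReal.ofReal ((s * r)⁻¹) * L) := by
  set κ := stdGaussian (EuclideanSpace ℝ (Fin (m + 1)))
  set ν := Measure.pi fun _ : Fin n => stdGaussian (EuclideanSpace ℝ (Fin (q + 1))) with hν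
  set B : Set (EuclideanSpace ℝ (Fin (m + 1))) := {ξ | 1 < ‖s • ξ‖} with hB
  have hBm : MeasurableSet B := measurableSet_lt (by fun_prop) (by fun_prop)
  have hθ (ξ : EuclideanSpace ℝ (Fin (m + 1))) (hξ : ξ ∉ B) :
      RegParam.noiseless (scaledCoef h s ξ) ∈ identitySpace q M 1 0 1 :=
    RegParam.noiseless_mem_identitySpace hM
      (((padZeros h).norm_map _).trans_le (not_lt.1 hξ))
  let D (z : EuclideanSpace ℝ (Fin (m + 1)) × (Fin n → EuclideanSpace ℝ (Fin (q + 1)))) :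
    Sample n q := noiselessSample (scaledCoef h s z.1) z.2
  have hD : Measurable D := measurable_noiselessSample.comp
    (((measurable_scaledCoef h s).comp measurable_fst).prodMk measurable_snd)
  have hDX (ξ : EuclideanSpace ℝ (Fin (m + 1))) : Measurable (noiselessSample (scaledCoef h s ξ) :
      (Fin n → EuclideanSpace ℝ (Fin (q + 1))) → Sample n q) :=
    measurable_noiselessSample.comp measurable_prodMk_left
  have hb : Measurable fun z : EuclideanSpace ℝ (Fin (m + 1)) ×
      (Fin n → EuclideanSpace ℝ (Fin (q + 1))) => scaledCoef h s z.1 0 := by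
    simp_rw [scaledCoef_zero]
    fun_prop
  have hIl := I.measurable_lower
  have hIu := I.measurable_upper
  let cover : Set (EuclideanSpace ℝ (Fin (m + 1)) × (Fin n → EuclideanSpace ℝ (Fin (q + 1)))) :=
    {z | I.lower (D z) ≤ scaledCoef h s z.1 0 ∧ scaledCoef h s z.1 0 ≤ I.upper (D z)}
  have hcover : MeasurableSet cover :=
    (measurableSet_le (hIl.comp hD) hb).inter (measurableSet_le hb (hIu.comp hD))
  let c := ENNReal.ofReal ((s * r)⁻¹)
  let f (z : EuclideanSpace ℝ (Fin (m + 1)) × (Fin n → EuclideanSpace ℝ (Fin (q + 1)))) : ℝ≥0∞ :=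
    min 1 (c * ENNReal.ofReal (I.upper (D z) - I.lower (D z)))
  have hf : Measurable f := measurable_const.min
    (((hIu.comp hD).sub (hIl.comp hD)).ennreal_ofReal.const_mul c)
  let A : Set (Fin n → EuclideanSpace ℝ (Fin (q + 1))) :=
    {X | (fun i => firstCoords h (X i)) ∈ nearRowSpace n (r ^ 2) 0}
  have hA : MeasurableSet A := by
    refine (isOpen_nearRowSpace (n := n) (η := r ^ 2) (0 : Fin (m + 1))).measurableSet.preimage ?_
    exact measurable_pi_lambda _ fun i => (measurable_firstCoords h).comp (measurable_pi_apply i)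
  calc ENNReal.ofReal (1 - α) * κ Bᶜ
      = ∫⁻ _ in Bᶜ, ENNReal.ofReal (1 - α) ∂κ := by rw [setLIntegral_const]
    _ ≤ ∫⁻ ξ in Bᶜ, ν (Prod.mk ξ ⁻¹' cover) ∂κ := by
        refine setLIntegral_mono (measurable_measure_prodMk_left hcover) fun ξ hξ => ?_
        have h1 := hI _ (hθ ξ hξ)
        have hc : MeasurableSet {D | I.lower D ≤ (RegParam.noiseless (scaledCoef h s ξ)).beta ∧
            (RegParam.noiseless (scaledCoef h s ξ)).beta ≤ I.upper D} :=
          (measurableSet_le hIl measurable_const).inter (measurableSet_le measurable_const hIu)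
        rwa [RegParam.law_noiseless, Measure.map_apply (hDX ξ) hc] at h1
    _ ≤ ∫⁻ ξ, ν (Prod.mk ξ ⁻¹' cover) ∂κ := setLIntegral_le_lintegral _ _
    _ = ∫⁻ X, κ ((fun ξ => (ξ, X)) ⁻¹' cover) ∂ν := by
        rw [← Measure.prod_apply hcover, Measure.prod_apply_symm hcover]
    _ ≤ ∫⁻ X, (A.indicator 1 X + ∫⁻ ξ, f (ξ, X) ∂κ) ∂ν := by
        refine lintegral_mono fun X => ?_
        by_cases hX : X ∈ A
        · rw [Set.indicator_of_mem hX]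
          exact prob_le_one.trans le_self_add
        · exact (cover_le_of_notMem_nearRowSpace I h hs hr X hX).trans le_add_self
    _ = ν A + ∫⁻ ξ, ∫⁻ X, f (ξ, X) ∂ν ∂κ := by
        rw [lintegral_add_left (measurable_one.indicator hA), lintegral_indicator_one hA,
          lintegral_lintegral_swap (f := fun X ξ => f (ξ, X))
            (hf.comp measurable_swap).aemeasurable]
    -- Outside the unit ball no length bound is available, and the truncation of `f` at `1` takes
    -- over.
    _ ≤ ν A + ∫⁻ ξ, (B.indicator 1 ξ + c * L) ∂κ := by
        gcongr with ξ
        by_cases hξ : ξ ∈ B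
        · rw [Set.indicator_of_mem hξ]
          refine le_trans ?_ le_self_add
          calc _ ≤ ∫⁻ _, 1 ∂ν := lintegral_mono fun X => min_le_left _ _
            _ = _ := by simp [hν]
        · refine le_trans ?_ le_add_self
          have h1 := hL _ (hθ ξ hξ)
          rw [expectedLength, RegParam.law_noiseless,
            lintegral_map (by fun_prop) (hDX ξ)] at h1
          calc _ ≤ ∫⁻ X, c * ENNReal.ofReal (I.upper (D (ξ, X)) - I.lower (D (ξ, X))) ∂ν :=
                lintegral_mono fun X => min_le_right _ _
            _ = c * ∫⁻ X, ENNReal.ofReal (I.upper (D (ξ, X)) - I.lower (D (ξ, X))) ∂ν :=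
                lintegral_const_mul _ (((hIu.sub hIl).ennreal_ofReal).comp (hDX ξ))
            _ ≤ c * L := by gcongr
    _ = _ := by
        rw [lintegral_add_right _ measurable_const, lintegral_indicator_one hBm,
          lintegral_const, measure_univ, mul_one, measure_firstCoords_nearRowSpace]

/-- Any uniform bound `L` is allowed: the supremum gives the minimax claims, and `L = 0` rules out
exact recovery. -/
theorem length_lower_bound {M α : ℝ} (hM : 1 < M) (hα : α < 1 / 3) (hn : 0 < n)
    (h : 2 * n + 1 ≤ q + 1) (hI : I ∈ validCI n α (identitySpace q M 1 0 1)) {L : ℝ≥0∞}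
    (hL : ∀ θ ∈ identitySpace q M 1 0 1, expectedLength I θ ≤ L) :
    ENNReal.ofReal (1 / 1600 * (n : ℝ) ^ (-(1 / 2) : ℝ)) ≤ L := by
  rcases eq_or_ne L ⊤ with rfl | hLt
  · exact le_top
  have hn1 : (1 : ℝ) ≤ n := by exact_mod_cast hn
  -- Chosen so that `s² (2n+1) ≤ 3n/(60n) = 1/20`.
  set s : ℝ := √(1 / (60 * n)) with hs
  have hs0 : 0 < s := by positivity
  have hs2 : s ^ 2 = 1 / (60 * n) := Real.sq_sqrt (by positivity)
  have key := coverage_le_length I h hM hs0 (r := 1 / 10) (by norm_num) hI hL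
  have hA := measure_nearRowSpace_le (n := n) (η := (1 / 10) ^ 2) (by norm_num)
    (0 : Fin (2 * n + 1))
  have hB := stdGaussian_norm_gt_one_le (ι := Fin (2 * n + 1)) (s := s)
  set κ := stdGaussian (EuclideanSpace ℝ (Fin (2 * n + 1)))
  set B : Set (EuclideanSpace ℝ (Fin (2 * n + 1))) := {ξ | 1 < ‖s • ξ‖}
  have hBm : MeasurableSet B := measurableSet_lt (by fun_prop) (by fun_prop)
  set a := Measure.pi (fun _ : Fin n => stdGaussian (EuclideanSpace ℝ (Fin (2 * n + 1))))
          (nearRowSpace n ((1 / 10) ^ 2) 0)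
  have hat : a ≠ ⊤ := measure_ne_top _ _
  have hbt : κ B ≠ ⊤ := measure_ne_top _ _
  have hb1 : κ B ≤ 1 := prob_le_one
  rw [prob_compl_eq_one_sub hBm] at key
  generalize κ B = b at key hB hbt hb1
  clear_value a
  lift a to ℝ≥0 using hat
  lift b to ℝ≥0 using hbt
  lift L to ℝ≥0 using hLt
  have hA' : (2 * n + 1 : ℝ) * a ≤ n / (1 - (1 / 10) ^ 2) := by
    have := ENNReal.toReal_le_of_le_ofReal (div_nonneg n.cast_nonneg (by norm_num)) hA
    rw [ENNReal.toReal_mul, ENNReal.toReal_natCast, Fintype.card_fin] at this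
    exact_mod_cast this
  have hB' : (b : ℝ) ≤ s ^ 2 * (2 * n + 1) := by
    have := ENNReal.toReal_le_of_le_ofReal (by positivity) hB
    rw [Fintype.card_fin] at this
    exact_mod_cast this
  have key' : (1 - α) * (1 - b) ≤ a + (b + (s * (1 / 10))⁻¹ * L) := by
    have := ENNReal.toReal_mono (by finiteness) key
    rwa [ENNReal.toReal_mul, ENNReal.toReal_sub_of_le hb1 ENNReal.one_ne_top,
      ENNReal.toReal_add (by finiteness) (by finiteness),
      ENNReal.toReal_add (by finiteness) (by finiteness), ENNReal.toReal_mul,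
      ENNReal.toReal_ofReal (by linarith), ENNReal.toReal_ofReal (by positivity)] at this
  have hb : (b : ℝ) ≤ 1 / 20 := by
    refine hB'.trans ?_
    rw [hs2, div_mul_eq_mul_div, div_le_div_iff₀ (by positivity) (by norm_num)]
    linarith
  have ha' : (a : ℝ) ≤ 51 / 100 := by
    have : (n : ℝ) / (1 - (1 / 10) ^ 2) ≤ (2 * n + 1) * (51 / 100) := by
      norm_num
      linarith
    exact le_of_mul_le_mul_left (hA'.trans this) (by positivity)
  -- Coverage is at least `(2/3)(19/20) > 0.63`, while bad designs and large coefficients account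
  -- for at most `0.51 + 0.05`.
  have hsL : 1 / 20 ≤ (s * (1 / 10))⁻¹ * L := by nlinarith
  have hsL' : s / 200 ≤ L := by
    rw [inv_mul_eq_div, le_div_iff₀ (by positivity)] at hsL
    linarith
  have hfin : 1 / 1600 * (n : ℝ) ^ (-(1 / 2) : ℝ) ≤ s / 200 := by
    rw [Real.rpow_neg (by positivity), ← Real.sqrt_eq_rpow]
    -- This is `60 ≤ 8²`, and `8 * 200 = 1600`.
    have : (8 * √(n : ℝ))⁻¹ ≤ s := by
      refine Real.le_sqrt_of_sq_le ?_
      rw [inv_pow, mul_pow, Real.sq_sqrt (by positivity), one_div]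
      gcongr
      norm_num
    rw [mul_inv] at this
    linarith
  rw [ENNReal.ofReal_le_iff_le_toReal ENNReal.coe_ne_top]
  exact hfin.trans hsL'

/-- Enlarging `Θ` leaves fewer valid intervals and a larger supremum. -/
theorem minimaxLength_lower_bound {M α : ℝ} (hM : 1 < M) (hα : α < 1 / 3) (hn : 0 < n)
    (h : 2 * n + 1 ≤ q + 1) {Θ : Set (RegParam q)} (hΘ : identitySpace q M 1 0 1 ⊆ Θ) :
    ENNReal.ofReal (1 / 1600 * (n : ℝ) ^ (-(1 / 2) : ℝ)) ≤ minimaxLength n α Θ Θ :=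
  le_iInf₂ fun I hI => length_lower_bound I hM hα hn h (fun θ hθ => hI θ (hΘ hθ))
    fun θ hθ => le_iSup₂ (f := fun θ _ => expectedLength I θ) θ (hΘ hθ)

end MinimaxBound

end

theorem theorem8 (α : ℝ) (hα : α ∈ Set.Ioo (0 : ℝ) (1 / 3)) :
    ∃ C : ℝ, 0 < C ∧ ∀ (n p : ℕ) (M : ℝ), 0 < n → 2 * n + 1 ≤ p → 1 < M →
      -- the minimax length without noise, with `s = 1` and unknown covariance
      ENNReal.ofReal (C * (n : ℝ) ^ (-(1 / 2) : ℝ)) ≤ minimaxA n (p - 1) α M 1 0 1 ∧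
      -- the same when the covariance is known to be the identity
      ENNReal.ofReal (C * (n : ℝ) ^ (-(1 / 2) : ℝ)) ≤
        minimaxLength n α (identitySpace (p - 1) M 1 0 1) (identitySpace (p - 1) M 1 0 1) ∧
      -- hence exact recovery is impossible
      ∀ b : Sample n (p - 1) → ℝ, Measurable b →
        ∃ θ ∈ identitySpace (p - 1) M 1 0 1,
          θ.law n {D | b D = θ.beta} < ENNReal.ofReal (1 - α) := by
  refine ⟨1 / 1600, by norm_num, fun n p M hn hp hM => ?_⟩
  have h : 2 * n + 1 ≤ p - 1 + 1 := by omega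
  refine ⟨minimaxLength_lower_bound hM hα.2 hn h fun θ hθ => hθ.1,
    minimaxLength_lower_bound hM hα.2 hn h subset_rfl, fun b hb => ?_⟩
  by_contra! hcov
  have hn' : (0 : ℝ) < n := by exact_mod_cast hn
  -- An estimator exact with probability `1 - α` would make `[b, b]` a valid interval of length
  -- zero.
  have hlen := length_lower_bound ⟨b, b, hb, hb⟩ hM hα.2 hn h (L := 0)
    (fun θ hθ => (hcov θ hθ).trans_eq ?_) fun θ _ => by simp [expectedLength]
  · rw [nonpos_iff_eq_zero, ENNReal.ofReal_eq_zero, ← not_lt] at hlen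
    exact hlen (by positivity)
  · congr 1
    ext D
    exact ⟨fun hD => ⟨hD.le, hD.ge⟩, fun hD => le_antisymm hD.1 hD.2⟩
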